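/- **Theorem 3.3.** Conventions. For a topological space $X$, $C_k(X,2)$ is the group of all continuous functions from $X$ to the discrete two-element group $2=\{0,1\}=\mathbb Z/2$, with pointwise addition and the compact-open topology; $X'$ is the set of non-isolated points of $X$. A space is *zero-dimensional* if its clopen sets form a base. A regular Hausdorff space $Y$ is *Ascoli* if for every compact set $\mathcal K$ of the space $C_k(Y)$ of continuous functions $Y\to\mathbb R$ with the compact-open topology, the evaluation map $Y\times\mathcal K\to\mathbb R$, $(y,f)\mapsto f(y)$, is continuous. A space $Y$ is a *$k_{\mathbb R}$-space* if a function $f:Y\to\mathbb R$ is continuous if and only if $f|_K$ is continuous for every compact $K\subseteq Y$, and a *$k$-space* if every non-closed $A\subseteq Y$ admits a compact $K\subseteq Y$ such that $A\cap K$ is not closed in $K$. The *box topology* on a direct sum $\bigoplus_{n\in\mathbb N}G_n$ of topological abelian groups is the group topology in which the sets $\bigoplus_{n}G_n\cap\prod_{n}U_n$, with each $U_n$ an open neighbourhood of the identity in $G_n$, form a neighbourhood base at the identity. For a cardinal $\kappa$, $2^{\kappa}$ carries the product topology. Let $X$ be a zero-dimensional metric space. The following assertions are equivalent: 1. $C_k(X,2)$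 is an Ascoli space; 2. $C_k(X,2)$ is a $k_{\mathbb R}$-space; 3. either (3a) $X$ is locally compact, or (3b) $X$ is not locally compact but $X'$ is compact. Moreover, in case (3a), $C_k(X,2)$ is topologically isomorphic to the product of a family of Polish abelian topological groups. In case (3b), the subgroup $$H=\{f\in C_k(X,2): f|_{X'}\equiv 0\}$$ of $C_k(X,2)$ is open, is a $k$-space, and is topologically isomorphic to the direct sum $\bigoplus_{n\in\mathbb N}2^{\kappa_n}$ endowed with the box topology, for some sequence $(\kappa_n)_{n\in\mathbb N}$ of non-zero cardinal numbers. -/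

import Mathlib

universe u v

open Set Topology

noncomputable section

/-- A topological space is zero-dimensional if its clopen subsets form a base of its topology
(Hausdorffness is automatic for the metric spaces considered below). -/
def IsZeroDimensional (X : Type u) [TopologicalSpace X] : Prop :=
  TopologicalSpace.IsTopologicalBasis {s : Set X | IsClopen s}

/-- A `k_ℝ`-space: a real-valued function is continuous if and only if its restriction to every
compact subset is continuous. -/
def IsKRSpace (Y : Type u) [TopologicalSpace Y] : Prop :=
  ∀ f : Y → ℝ, Continuous f ↔ ∀ K : Set Y, IsCompact K → Continuous (K.domRestrict f)

/-- A set `𝒦` of continuous functions is evenly continuous if the restriction of the evaluation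
map `(x, f) ↦ f x` to `Y × 𝒦` is jointly continuous, where `C(Y, Z)` has the compact-open
topology. -/
def IsEvenlyContinuous {Y : Type u} {Z : Type v} [TopologicalSpace Y] [TopologicalSpace Z]
    (𝒦 : Set C(Y, Z)) : Prop :=
  Continuous (fun p : Y × 𝒦 => (p.2 : C(Y, Z)) p.1)

/-- An Ascoli space: a regular Hausdorff space `Y` such that every compact subset of `C(Y, ℝ)`
(with the compact-open topology) is evenly continuous. -/
def IsAscoliSpace (Y : Type u) [TopologicalSpace Y] : Prop :=
  T3Space Y ∧ ∀ 𝒦 : Set C(Y, ℝ), IsCompact 𝒦 → IsEvenlyContinuous 𝒦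

/-- The subgroup of those `f ∈ C(X, 2)` that vanish on a set `S`. The doubleton `2 = {0, 1}` is
the discrete group `ZMod 2`, and `C(X, ZMod 2)` has the pointwise operations and the compact-open
topology. -/
def vanishingSubgroup (X : Type u) [TopologicalSpace X] (S : Set X) :
    AddSubgroup C(X, ZMod 2) where
  carrier := {f | ∀ x ∈ S, f x = 0}
  add_mem' := by
    intro f g hf hg x hx
    simp [hf x hx, hg x hx]
  zero_mem' := by
    intro x _
    rfl
  neg_mem' := by
    intro f hf x hx
    simp [hf x hx]

/-- The box topology on a product `∏ₙ Gₙ`: its base consists of the boxes `∏ₙ Uₙ` with every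
`Uₙ` open. -/
abbrev boxTopology (G : ℕ → Type u) [∀ n, TopologicalSpace (G n)] : TopologicalSpace (∀ n, G n) :=
  TopologicalSpace.generateFrom
    {B | ∃ U : ∀ n, Set (G n), (∀ n, IsOpen (U n)) ∧ B = {x | ∀ n, x n ∈ U n}}

/-- The direct sum `⨁ₙ Gₙ` of a sequence of abelian groups, as a type synonym that carries the
box topology. -/
def BoxDirectSum (G : ℕ → Type u) [∀ n, AddCommGroup (G n)] : Type u :=
  DirectSum ℕ G

instance BoxDirectSum.instAddCommGroup (G : ℕ → Type u) [∀ n, AddCommGroup (G n)] :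
    AddCommGroup (BoxDirectSum G) :=
  inferInstanceAs (AddCommGroup (DirectSum ℕ G))

/-- The topology on the direct sum induced from the box topology on the full product. -/
instance BoxDirectSum.instTopologicalSpace (G : ℕ → Type u) [∀ n, AddCommGroup (G n)]
    [∀ n, TopologicalSpace (G n)] : TopologicalSpace (BoxDirectSum G) :=
  (boxTopology G).induced (fun (x : DirectSum ℕ G) (n : ℕ) => x n)

/-- The compact group `2 ^ κ`: the power of the discrete group `ZMod 2` over a set of cardinality
`κ`, with the product topology. -/
abbrev TwoPow (κ : Cardinal.{u}) : Type u :=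
  κ.out → ZMod 2

end

/-!
The compact-open topology on `C(X, 2)` is governed by agreement on compact sets: since `2` is
discrete, the sets `{f | f = g on K}` with `K` compact form a base of neighbourhoods of `g`
(`mem_nhds_iff_exists_eqOn`).

If `X` is locally compact, paracompactness and zero-dimensionality split it into compact open
pieces, so `C(X, 2)` is a product of countable discrete groups, and an arbitrary product of
discrete spaces is a `k_ℝ`-space (`isKRSpace_pi_of_discreteTopology`). If `X` is not locally compact
but `X'` is compact, `X'` has a decreasing neighbourhood base `U n` whose consecutive differences are
nonempty and consist of isolated points. Compact sets meet each difference in a finite set, and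
finite subsets of the differences add up, together with `X'`, to a compact set. This turns the
open subgroup of maps vanishing on `X'` into a box sum, and shows that it carries the inductive
limit topology of its compact subgroups `{f | f = 0 on U n}`, hence is a `k`-space; a topological
group with an open `k`-subgroup is a `k_ℝ`-space.

A regular Hausdorff `k_ℝ`-space is Ascoli, because the evaluation `Y → C(𝒦, ℝ)` is continuous on
compact sets (`IsKRSpace.isAscoliSpace`). Conversely, if `X` has a point without compact
neighbourhoods and `X'` is not compact, one builds clopen sets in `C(X, 2)`, finitely many of which
meet any given compact set, with members that cluster at `0`; the indicators of these sets form,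
together with `0`, a compact set of real functions that is not evenly continuous
(`not_isAscoliSpace_of_not_locallyCompactSpace`).
-/

open Filter

/-! ### The compact-open topology for discrete targets -/

section DiscreteTarget

variable {X Y : Type*} [TopologicalSpace X] [TopologicalSpace Y] [DiscreteTopology Y]

theorem isOpen_setOf_eqOn (g : C(X, Y)) {K : Set X} (hK : IsCompact K) :
    IsOpen {f : C(X, Y) | EqOn f g K} := by
  have hfin : (g '' K).Finite := (hK.image g.continuous).finite_of_discrete
  have : {f : C(X, Y) | EqOn f g K} = ⋂ v ∈ g '' K, {f : C(X, Y) | MapsTo f (K ∩ g ⁻¹' {v}) {v}} := by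
    ext f
    simp only [mem_iInter]
    constructor
    · rintro h v - x ⟨hx, hv⟩
      rw [mem_singleton_iff, ← mem_singleton_iff.1 hv]
      exact h hx
    · intro h x hx
      exact h (g x) (mem_image_of_mem g hx) ⟨hx, rfl⟩
  rw [this]
  exact hfin.isOpen_biInter fun v _ => ContinuousMap.isOpen_setOfPred_mapsTo
    (hK.inter_right ((isClosed_discrete {v}).preimage g.continuous)) (isOpen_discrete _)

theorem mem_nhds_iff_exists_eqOn {g : C(X, Y)} {O : Set C(X, Y)} :
    O ∈ 𝓝 g ↔ ∃ K : Set X, IsCompact K ∧ ∀ f : C(X, Y), EqOn f g K → f ∈ O := by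
  constructor
  · intro h
    obtain ⟨S, ⟨hSfin, hS⟩, hSO⟩ := (ContinuousMap.hasBasis_nhds g).mem_iff.1 h
    refine ⟨⋃ p ∈ S, p.1, hSfin.isCompact_biUnion fun p hp => (hS p.1 p.2 hp).1, fun f hf => hSO ?_⟩
    simp only [mem_iInter]
    intro p hp x hx
    have hx' := (hS p.1 p.2 hp).2.2 hx
    rwa [← hf (mem_biUnion hp hx)] at hx'
  · rintro ⟨K, hK, h⟩
    exact mem_of_superset ((isOpen_setOf_eqOn g hK).mem_nhds fun _ _ => rfl) h

theorem discreteTopology_continuousMap [CompactSpace X] : DiscreteTopology C(X, Y) := by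
  refine discreteTopology_iff_isOpen_singleton.2 fun g => ?_
  convert isOpen_setOf_eqOn g isCompact_univ
  ext f
  simp [DFunLike.ext_iff]

/-- Compact sets of continuous maps into a discrete space are equicontinuous. It suffices to look
at a convergent sequence and its limit, a compact set on which only finitely many restrictions
occur. -/
theorem IsCompact.eventually_forall_apply_eq [FirstCountableTopology X] {C : Set C(X, Y)}
    (hC : IsCompact C) (x : X) : ∀ᶠ z in 𝓝 x, ∀ f ∈ C, f z = f x := by
  by_contra hcon
  obtain ⟨z, hz, hzC⟩ := exists_seq_forall_of_frequently (not_eventually.1 hcon)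
  push Not at hzC
  choose g hgC hg using hzC
  have hK : IsCompact (insert x (range z)) := hz.isCompact_insert_range
  obtain ⟨t, -, ht⟩ := hC.elim_nhds_subcover (fun f : C(X, Y) => {h : C(X, Y) | EqOn h f _})
    fun f _ => (isOpen_setOf_eqOn f hK).mem_nhds fun _ _ => rfl
  have hev : ∀ᶠ n in atTop, ∀ f ∈ t, f (z n) = f x := by
    rw [eventually_all_finset]
    intro f _
    exact (f.continuous.tendsto x).comp hz |>.eventually
      ((isOpen_discrete {f x}).mem_nhds rfl)
  obtain ⟨n, hn⟩ := hev.exists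
  obtain ⟨f, hft, hf⟩ := mem_iUnion₂.1 (ht (hgC n))
  apply hg n
  rw [hf (mem_insert_of_mem _ (mem_range_self n)), hf (mem_insert _ _), hn f hft]

end DiscreteTarget

/-! ### Ascoli spaces and `k_ℝ`-spaces -/

theorem IsKRSpace.isAscoliSpace {Y : Type u} [TopologicalSpace Y] [T3Space Y] (hY : IsKRSpace Y) :
    IsAscoliSpace Y := by
  refine ⟨inferInstance, fun 𝒦 h𝒦 => ?_⟩
  have : CompactSpace 𝒦 := isCompact_iff_compactSpace.1 h𝒦
  let e : Y → C(𝒦, ℝ) := fun y =>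
    ⟨fun f => f.1 y, (ContinuousEvalConst.continuous_eval_const y).comp continuous_subtype_val⟩
  have heK : ∀ K : Set Y, IsCompact K → Continuous fun y : K => e y := by
    intro K hK
    have : CompactSpace K := isCompact_iff_compactSpace.1 hK
    apply ContinuousMap.continuous_of_continuous_uncurry
    have : Continuous fun p : K × 𝒦 => (p.2.1.restrict K) p.1 :=
      (((ContinuousMap.continuous_restrict K).comp continuous_subtype_val).comp
        continuous_snd).eval continuous_fst
    exact this
  have he : Continuous e := by
    refine continuous_iff_continuousAt.2 fun y₀ => ?_
    have hd : Continuous fun y => dist (e y) (e y₀) :=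
      (hY _).2 fun K hK => (heK K hK).dist continuous_const
    have := hd.tendsto y₀
    simp only [dist_self] at this
    exact tendsto_iff_dist_tendsto_zero.2 this
  have : Continuous fun p : Y × 𝒦 => e p.1 p.2 := (he.comp continuous_fst).eval continuous_snd
  exact this

/-- A space is not Ascoli as soon as some point `z` is a cluster point of a family `a i` whose
members lie in clopen sets `U i`, only finitely many of which meet any given compact set: then the
indicators of the `U i` converge to `0` uniformly on compact sets, but not near `z`. -/
theorem not_isAscoliSpace_of_isClopen {Y : Type u} [TopologicalSpace Y] {ι : Type*}
    {U : ι → Set Y} (hU : ∀ i, IsClopen (U i)) {a : ι → Y} (ha : ∀ i, a i ∈ U i)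
    (hfin : ∀ C : Set Y, IsCompact C → {i | (C ∩ U i).Nonempty}.Finite) {z : Y}
    (hz : ∀ O ∈ 𝓝 z, ∃ᶠ i in cofinite, a i ∈ O) : ¬ IsAscoliSpace Y := by
  rintro ⟨-, hA⟩
  let φ : ι → C(Y, ℝ) := fun i => (LocallyConstant.charFn ℝ (hU i)).toContinuousMap
  have hφ : ∀ i y, φ i y = (U i).indicator 1 y := fun i y => by
    change (LocallyConstant.charFn ℝ (hU i)) y = _
    rw [LocallyConstant.coe_charFn]
  have hlim : Tendsto φ cofinite (𝓝 0) := by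
    rw [ContinuousMap.tendsto_nhds_compactOpen]
    intro C hC V _ hV
    refine mem_of_superset ((hfin C hC).compl_mem_cofinite) fun i hi y hy => ?_
    have hyU : y ∉ U i := fun h => hi ⟨y, hy, h⟩
    rw [hφ, indicator_of_notMem hyU]
    exact hV hy
  let 𝒦 : Set C(Y, ℝ) := insert 0 (range φ)
  have h𝒦 : IsCompact 𝒦 := hlim.isCompact_insert_range_of_cofinite
  let ψ : ι → 𝒦 := fun i => ⟨φ i, mem_insert_of_mem _ (mem_range_self i)⟩
  let o : 𝒦 := ⟨0, mem_insert _ _⟩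
  have hψ : Tendsto ψ cofinite (𝓝 o) := tendsto_subtype_rng.2 hlim
  have hcont : Continuous fun p : Y × 𝒦 => (p.2 : C(Y, ℝ)) p.1 := hA 𝒦 h𝒦
  have hev : ∀ᶠ p in 𝓝 (z, o), (p.2 : C(Y, ℝ)) p.1 < 1 :=
    hcont.continuousAt.eventually_lt_const (by simp [o])
  rw [nhds_prod_eq] at hev
  obtain ⟨p, hp, q, hq, hpq⟩ := eventually_prod_iff.1 hev
  obtain ⟨i, hi, hqi⟩ := ((hz _ hp).and_eventually (hψ.eventually hq)).exists
  have := hpq hi hqi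
  simp [ψ, hφ, ha i] at this

theorem IsKRSpace.of_homeomorph {Y Z : Type*} [TopologicalSpace Y] [TopologicalSpace Z]
    (hY : IsKRSpace Y) (e : Y ≃ₜ Z) : IsKRSpace Z := by
  intro f
  refine ⟨fun hf K _ => hf.comp continuous_subtype_val, fun hf => ?_⟩
  suffices Continuous (f ∘ e) by simpa using this
  refine (hY _).2 fun K hK => ?_
  rw [← continuousOn_iff_continuous_domRestrict]
  exact (continuousOn_iff_continuous_domRestrict.2 (hf _ (hK.image e.continuous))).comp
    e.continuous.continuousOn (mapsTo_image e K)

/-- Arbitrary products of discrete spaces are `k_ℝ`-spaces. If `f` is discontinuous at `x`, one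
finds points `y` agreeing with `x` on any prescribed finite set of coordinates whose values stay
away from `f x`. Continuity on compact boxes with at most two-point sides allows `y` to be replaced
by a point differing from `x` in finitely many coordinates only. A sequence of such points with
disjoint supports converges to `x`, against continuity on compact sets. -/
theorem isKRSpace_pi_of_discreteTopology {ι : Type u} {N : ι → Type v}
    [∀ i, TopologicalSpace (N i)] [∀ i, DiscreteTopology (N i)] : IsKRSpace (∀ i, N i) := by
  classical
  intro f
  refine ⟨fun hf K _ => hf.comp continuous_subtype_val, fun hf => ?_⟩
  replace hf : ∀ K, IsCompact K → ContinuousOn f K := fun K hK =>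
    continuousOn_iff_continuous_domRestrict.2 (hf K hK)
  refine continuous_iff_continuousAt.2 fun x => ?_
  by_contra hx
  rw [Metric.continuousAt_iff'] at hx
  push Not at hx
  obtain ⟨ε, hε, hx⟩ := hx
  -- Points away from `f x` that differ from `x` in finitely many coordinates, none of them in `F`.
  have hfinsupp : ∀ F : Finset ι, ∃ p : Finset ι × ∀ i, N i,
      (∀ i ∉ p.1, p.2 i = x i) ∧ ε / 2 ≤ dist (f p.2) (f x) ∧ ∀ i ∈ F, p.2 i = x i := by
    intro F
    have hF : ∀ᶠ y in 𝓝 x, ∀ i ∈ F, y i = x i := by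
      rw [eventually_all_finset]
      intro i _
      exact (continuous_apply i).tendsto x |>.eventually ((isOpen_discrete {x i}).mem_nhds rfl)
    obtain ⟨y, hy, hyF⟩ := (hx.and_eventually hF).exists
    let K : Set (∀ i, N i) := univ.pi fun i => {x i, y i}
    have hK : IsCompact K := isCompact_univ_pi fun i => (toFinite _).isCompact
    let w : Finset ι → ∀ i, N i := fun E => E.piecewise y x
    have hwK : ∀ E, w E ∈ K := by
      intro E i _
      by_cases hi : i ∈ E <;> simp [w, hi]
    have hw : Tendsto w atTop (𝓝[K] y) := by
      refine tendsto_nhdsWithin_iff.2 ⟨tendsto_pi_nhds.2 fun i => ?_, Eventually.of_forall hwK⟩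
      refine tendsto_const_nhds.congr' ?_
      filter_upwards [eventually_ge_atTop {i}] with E hE
      simp [w, Finset.singleton_subset_iff.1 hE]
    have hfw := (hf K hK y fun i _ => by simp).tendsto.comp hw
    obtain ⟨E, hE⟩ := (hfw.eventually (Metric.ball_mem_nhds _ (half_pos hε))).exists
    refine ⟨(E, w E), fun i hi => by simp [w, show i ∉ E from hi], ?_, fun i hi => ?_⟩
    · have h1 : dist (f (w E)) (f y) < ε / 2 := hE
      have h2 := dist_triangle_left (f y) (f x) (f (w E))
      change ε / 2 ≤ dist (f (w E)) (f x)
      linarith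
    · by_cases hiE : i ∈ E
      · simp [w, hiE, hyF i hi]
      · simp [w, hiE]
  obtain ⟨p, hp, hpr⟩ := exists_seq_of_forall_finset_exists
    (fun p : Finset ι × ∀ i, N i => (∀ i ∉ p.1, p.2 i = x i) ∧ ε / 2 ≤ dist (f p.2) (f x))
    (fun p q => ∀ i ∈ p.1, q.2 i = x i) (fun s _ => by
      obtain ⟨q, hq1, hq2, hq3⟩ := hfinsupp (s.biUnion Prod.fst)
      exact ⟨q, ⟨hq1, hq2⟩, fun r hr i hi => hq3 i (Finset.mem_biUnion.2 ⟨r, hr, hi⟩)⟩)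
  have hlim : Tendsto (fun n => (p n).2) atTop (𝓝 x) := by
    refine tendsto_pi_nhds.2 fun i => tendsto_const_nhds.congr' ?_
    by_cases hi : ∃ m, (p m).2 i ≠ x i
    · obtain ⟨m, hm⟩ := hi
      have him : i ∈ (p m).1 := by
        by_contra h
        exact hm ((hp m).1 i h)
      filter_upwards [eventually_gt_atTop m] with n hn
      exact (hpr m n hn i him).symm
    · push Not at hi
      exact Eventually.of_forall fun n => (hi n).symm
  have hlim' : Tendsto (fun n => (p n).2) atTop (𝓝[insert x (range fun n => (p n).2)] x) :=
    tendsto_nhdsWithin_iff.2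
      ⟨hlim, Eventually.of_forall fun n => mem_insert_of_mem _ (mem_range_self n)⟩
  have hflim := (hf _ hlim.isCompact_insert_range x (mem_insert _ _)).tendsto.comp hlim'
  obtain ⟨n, hn⟩ := (hflim.eventually (Metric.ball_mem_nhds _ (half_pos hε))).exists
  exact (hp n).2.not_gt hn

/-! ### Failure of the Ascoli property -/

theorem IsZeroDimensional.exists_isClopen {X : Type u} [TopologicalSpace X]
    (hX : IsZeroDimensional X) {x : X} {V : Set X} (hV : V ∈ 𝓝 x) :
    ∃ W : Set X, IsClopen W ∧ x ∈ W ∧ W ⊆ V := by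
  obtain ⟨W, hW, hxW, hWV⟩ := (TopologicalSpace.IsTopologicalBasis.mem_nhds_iff hX).1 hV
  exact ⟨W, hW, hxW, hWV⟩

/-- A closed noncompact subset of a zero-dimensional metric space contains a sequence without
cluster points, and its terms have a locally finite family of clopen neighbourhoods. -/
theorem IsZeroDimensional.exists_locallyFinite_isClopen {X : Type u} [MetricSpace X]
    (hX : IsZeroDimensional X) {A : Set X} (hA : IsClosed A) (hAc : ¬ IsCompact A) :
    ∃ (a : ℕ → X) (W : ℕ → Set X), (∀ k, a k ∈ A ∧ a k ∈ W k ∧ IsClopen (W k)) ∧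
      LocallyFinite W := by
  rw [isCompact_iff_isSeqCompact, IsSeqCompact] at hAc
  push Not at hAc
  obtain ⟨a, haA, ha⟩ := hAc
  choose W hWc haW hWb using fun k : ℕ =>
    hX.exists_isClopen (Metric.ball_mem_nhds (a k) (Nat.one_div_pos_of_nat (α := ℝ) (n := k)))
  refine ⟨a, W, fun k => ⟨haA k, haW k, hWc k⟩, fun x => ?_⟩
  by_contra hcon
  push Not at hcon
  have hclus : MapClusterPt x atTop a := by
    refine (Metric.nhds_basis_ball.mapClusterPt_iff_frequently).2 fun ε hε => ?_
    have hinf := hcon _ (Metric.ball_mem_nhds x (half_pos hε))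
    have hev : ∀ᶠ k : ℕ in atTop, 1 / ((k : ℝ) + 1) < ε / 2 :=
      tendsto_one_div_add_atTop_nhds_zero_nat.eventually_lt_const (half_pos hε)
    refine ((Nat.frequently_atTop_iff_infinite.2 hinf).and_eventually hev).mono ?_
    rintro k ⟨⟨y, hyW, hyx⟩, hk⟩
    have h1 : dist y (a k) < 1 / ((k : ℝ) + 1) := hWb k hyW
    have h2 : dist y x < ε / 2 := hyx
    have h3 := dist_triangle_left (a k) x y
    rw [Metric.mem_ball]
    linarith
  obtain ⟨φ, hφ, hlim⟩ := hclus.tendsto_subseq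
  exact ha x (hA.mem_of_tendsto hlim (Eventually.of_forall fun n => haA _)) φ hφ hlim

theorem exists_forall_not_isCompact_closedBall {X : Type u} [MetricSpace X]
    (h : ¬ LocallyCompactSpace X) :
    ∃ x : X, ∀ n : ℕ, ¬ IsCompact (Metric.closedBall x (1 / ((n : ℝ) + 1))) := by
  by_contra! hcon
  refine h ?_
  have : WeaklyLocallyCompactSpace X := ⟨fun x => by
    obtain ⟨n, hn⟩ := hcon x
    exact ⟨_, hn, Metric.closedBall_mem_nhds x Nat.one_div_pos_of_nat⟩⟩
  infer_instance

theorem isClopen_setOf_apply_ne {X Y : Type*} [TopologicalSpace X] [TopologicalSpace Y]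
    [DiscreteTopology Y] (x y : X) : IsClopen {f : C(X, Y) | f x ≠ f y} := by
  have h : Continuous fun f : C(X, Y) => (f x, f y) :=
    (ContinuousEvalConst.continuous_eval_const x).prodMk
      (ContinuousEvalConst.continuous_eval_const y)
  exact (isClopen_discrete {p : Y × Y | p.1 ≠ p.2}).preimage h

/-- Let `x₀` be a point without compact neighbourhoods and `x n` a sequence of non-isolated points
without cluster points. The sets `U n k` of maps that distinguish `p n k` from `x n` and `q n k`
from `x₀`, where `p n k → x n` for fixed `n` and the points `q n k` for fixed `n` form a sequence
without cluster points in the `n`-th ball around `x₀`, violate the Ascoli property at `0`. -/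
theorem not_isAscoliSpace_of_not_locallyCompactSpace {X : Type u} [MetricSpace X]
    (hX : IsZeroDimensional X) (hlc : ¬ LocallyCompactSpace X)
    (hX' : ¬ IsCompact (derivedSet (univ : Set X))) : ¬ IsAscoliSpace C(X, ZMod 2) := by
  obtain ⟨x₀, hx₀⟩ := exists_forall_not_isCompact_closedBall hlc
  obtain ⟨x, V, hxV, hV⟩ := hX.exists_locallyFinite_isClopen (isClosed_derivedSet _) hX'
  have hp : ∀ n k : ℕ, ∃ (p : X) (P : Set X), p ∈ P ∧ IsClopen P ∧ P ⊆ V n ∧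
      x n ∉ P ∧ x₀ ∉ P ∧ p ∈ Metric.ball (x n) (1 / ((k : ℝ) + 1)) := by
    intro n k
    have : (𝓝[≠] x n).NeBot := by simpa [derivedSet, AccPt] using (hxV n).1
    have h₀ : ∀ᶠ y in 𝓝[≠] x n, y ≠ x₀ := by
      by_cases h : x n = x₀
      · rw [← h]
        exact eventually_mem_nhdsWithin
      · exact nhdsWithin_le_nhds (eventually_ne_nhds h)
    have h₁ : ∀ᶠ y in 𝓝[≠] x n, y ∈ V n ∩ Metric.ball (x n) (1 / ((k : ℝ) + 1)) :=
      nhdsWithin_le_nhds (inter_mem ((hxV n).2.2.isOpen.mem_nhds (hxV n).2.1)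
        (Metric.ball_mem_nhds _ Nat.one_div_pos_of_nat))
    obtain ⟨p, ⟨⟨hpV, hpb⟩, hpx₀⟩, hpx⟩ := ((h₁.and h₀).and eventually_mem_nhdsWithin).exists
    have hO : V n ∩ {x n, x₀}ᶜ ∈ 𝓝 p := ((hxV n).2.2.isOpen.inter
      (toFinite {x n, x₀}).isClosed.isOpen_compl).mem_nhds ⟨hpV, by simp [hpx₀, show p ≠ x n from hpx]⟩
    obtain ⟨P, hP, hpP, hPs⟩ := hX.exists_isClopen hO
    exact ⟨p, P, hpP, hP, fun y hy => (hPs hy).1, fun h => (hPs h).2 (by simp),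
      fun h => (hPs h).2 (by simp), hpb⟩
  choose p P hpP hPc hPV hxP hx₀P hpb using hp
  have hq : ∀ n : ℕ, ∃ (q : ℕ → X) (Q : ℕ → Set X), (∀ k, q k ∈ Q k ∧ IsClopen (Q k) ∧
      x n ∉ Q k ∧ x₀ ∉ Q k ∧ q k ∈ Metric.closedBall x₀ (1 / ((n : ℝ) + 1))) ∧
      LocallyFinite Q := by
    intro n
    obtain ⟨a, W, haW, hW⟩ := hX.exists_locallyFinite_isClopen Metric.isClosed_closedBall (hx₀ n)
    have hev : ∀ y, ∀ᶠ k in atTop, y ∉ W k := fun y => by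
      rw [← Nat.cofinite_eq_atTop]
      exact (hW.point_finite y).compl_mem_cofinite
    obtain ⟨k₀, hk₀⟩ := eventually_atTop.1 ((hev (x n)).and (hev x₀))
    refine ⟨fun k => a (k + k₀), fun k => W (k + k₀), fun k => ?_,
      hW.comp_injective (add_left_injective k₀)⟩
    exact ⟨(haW _).2.1, (haW _).2.2, (hk₀ _ (Nat.le_add_left _ _)).1,
      (hk₀ _ (Nat.le_add_left _ _)).2, (haW _).1⟩
  choose q Q hqQ hQ using hq
  have hPQ : ∀ i : ℕ × ℕ, IsClopen (P i.1 i.2 ∪ Q i.1 i.2) := fun i =>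
    (hPc _ _).union (hqQ _ _).2.1
  let a : ℕ × ℕ → C(X, ZMod 2) := fun i => (LocallyConstant.charFn (ZMod 2) (hPQ i)).toContinuousMap
  have ha : ∀ i y, a i y = (P i.1 i.2 ∪ Q i.1 i.2).indicator 1 y := fun i y => by
    change (LocallyConstant.charFn (ZMod 2) (hPQ i)) y = _
    rw [LocallyConstant.coe_charFn]
  refine not_isAscoliSpace_of_isClopen (ι := ℕ × ℕ) (z := 0) (a := a)
    (U := fun i => {f | f (p i.1 i.2) ≠ f (x i.1)} ∩ {f | f (q i.1 i.2) ≠ f x₀})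
    (fun i => (isClopen_setOf_apply_ne _ _).inter (isClopen_setOf_apply_ne _ _)) ?_ ?_ ?_
  · rintro ⟨n, k⟩
    simp [ha, hpP, hxP, hx₀P, hqQ]
  · intro C hC
    obtain ⟨ε, hε, hball⟩ := Metric.eventually_nhds_iff.1 (hC.eventually_forall_apply_eq x₀)
    obtain ⟨n₀, hn₀⟩ := eventually_atTop.1
      (tendsto_one_div_add_atTop_nhds_zero_nat.eventually_lt_const hε)
    have hk : ∀ n, {k | ∃ f ∈ C, f (p n k) ≠ f (x n)}.Finite := by
      intro n
      have hlim : Tendsto (p n) atTop (𝓝 (x n)) := by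
        rw [tendsto_iff_dist_tendsto_zero]
        exact squeeze_zero (fun _ => dist_nonneg) (fun k => (Metric.mem_ball.1 (hpb n k)).le)
          tendsto_one_div_add_atTop_nhds_zero_nat
      have := hlim.eventually (hC.eventually_forall_apply_eq (x n))
      rw [← Nat.cofinite_eq_atTop, eventually_cofinite] at this
      simpa using this
    refine ((finite_lt_nat n₀).biUnion fun n _ => (finite_singleton n).prod (hk n)).subset ?_
    rintro ⟨n, k⟩ ⟨f, hfC, hfp, hfq⟩
    refine mem_biUnion (x := n) ?_ ⟨rfl, f, hfC, hfp⟩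
    by_contra hn
    exact hfq (hball (((hqQ n k).2.2.2.2).trans_lt (hn₀ n (not_lt.1 hn))) f hfC)
  · intro O hO
    obtain ⟨K, hK, hKO⟩ := mem_nhds_iff_exists_eqOn.1 hO
    obtain ⟨n, hn⟩ := (hV.finite_nonempty_inter_compact hK).exists_notMem
    have hkn := ((hQ n).finite_nonempty_inter_compact hK).compl_mem_cofinite
    have hev : ∀ᶠ k in cofinite, a (n, k) ∈ O := by
      filter_upwards [hkn] with k hk
      refine hKO _ fun y hy => ?_
      have hyP : y ∉ P n k := fun h => hn ⟨y, hPV n k h, hy⟩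
      have hyQ : y ∉ Q n k := fun h => hk ⟨y, h, hy⟩
      simp [ha, hyP, hyQ]
    exact (Prod.mk_right_injective n).tendsto_cofinite.frequently hev.frequently

/-! ### Locally compact spaces -/

/-- A locally finite cover by compact open sets is obtained from paracompactness and the shrinking
lemma; removing from each member the union of its predecessors in a well-ordering makes the cover
disjoint, and keeps it clopen by local finiteness. -/
theorem IsZeroDimensional.exists_partition_isCompact_isOpen {X : Type u} [MetricSpace X]
    [LocallyCompactSpace X] (hX : IsZeroDimensional X) :
    ∃ D : X → Set X, (∀ i, IsOpen (D i)) ∧ (∀ i, IsCompact (D i)) ∧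
      Pairwise (Function.onFun Disjoint D) ∧ ⋃ i, D i = univ := by
  have hN : ∀ x : X, ∃ W : Set X, IsOpen W ∧ IsCompact W ∧ x ∈ W := by
    intro x
    obtain ⟨K, hK, hxK⟩ := exists_compact_mem_nhds x
    obtain ⟨W, hW, hxW, hWK⟩ := hX.exists_isClopen hxK
    exact ⟨W, hW.isOpen, hK.of_isClosed_subset hW.isClosed hWK, hxW⟩
  choose N hNo hNc hxN using hN
  obtain ⟨V, hVo, hVU, hVf, hVN⟩ := precise_refinement N hNo
    (iUnion_eq_univ_iff.2 fun x => ⟨x, hxN x⟩)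
  obtain ⟨C, hCU, hC, hCV⟩ := exists_iUnion_eq_closed_subset hVo hVf.point_finite hVU
  have hW : ∀ i, ∃ W : Set X, IsOpen W ∧ IsCompact W ∧ C i ⊆ W ∧ W ⊆ V i := by
    intro i
    have hCc : IsCompact (C i) := (hNc i).of_isClosed_subset (hC i) ((hCV i).trans (hVN i))
    have hB : ∀ x : C i, ∃ B : Set X, IsClopen B ∧ x.1 ∈ B ∧ B ⊆ V i := fun x =>
      hX.exists_isClopen ((hVo i).mem_nhds (hCV i x.2))
    choose B hB hxB hBV using hB
    obtain ⟨t, ht⟩ := hCc.elim_finite_subcover B (fun x => (hB x).isOpen)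
      fun x hx => mem_iUnion.2 ⟨⟨x, hx⟩, hxB _⟩
    have hcl : IsClopen (⋃ x ∈ t, B x) := t.finite_toSet.isClopen_biUnion fun x _ => hB x
    have hsub : ⋃ x ∈ t, B x ⊆ V i := iUnion₂_subset fun x _ => hBV x
    exact ⟨_, hcl.isOpen, (hNc i).of_isClosed_subset hcl.isClosed (hsub.trans (hVN i)), ht, hsub⟩
  choose W hWo hWc hCW hWV using hW
  have hWf : LocallyFinite W := hVf.subset hWV
  obtain ⟨_, _⟩ := exists_wellFoundedLT (α := X)
  have hcl : ∀ i, IsClosed (⋃ j : Iio i, W j.1) := fun i =>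
    (hWf.comp_injective Subtype.val_injective).isClosed_iUnion
      fun j => (hWc j.1).isClosed
  refine ⟨fun i => W i \ ⋃ j : Iio i, W j.1, fun i => (hWo i).sdiff (hcl i), fun i => ?_, ?_, ?_⟩
  · exact (hWc i).diff (isOpen_iUnion fun j => hWo j)
  · refine pairwise_disjoint_on _ |>.2 fun i j hij => disjoint_left.2 fun x hxi hxj => ?_
    exact hxj.2 (mem_iUnion.2 ⟨⟨i, hij⟩, hxi.1⟩)
  · refine iUnion_eq_univ_iff.2 fun x => ?_
    have hne : {i | x ∈ W i}.Nonempty := by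
      obtain ⟨i, hi⟩ := iUnion_eq_univ_iff.1 hCU x
      exact ⟨i, hCW i hi⟩
    refine ⟨wellFounded_lt.min _ hne, wellFounded_lt.min_mem _ hne, fun hx => ?_⟩
    obtain ⟨⟨j, hj⟩, hxj⟩ := mem_iUnion.1 hx
    exact wellFounded_lt.not_lt_min {i | x ∈ W i} hxj hj

/-- For a partition of `X` into open sets `D i`, restriction identifies `C(X, Y)` with the product
of the groups `C(D i, Y)`, as a topological group. -/
noncomputable def ContinuousMap.piRestrict {X Y ι : Type*} [TopologicalSpace X]
    [TopologicalSpace Y] [AddGroup Y] [IsTopologicalAddGroup Y] {D : ι → Set X}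
    (hDo : ∀ i, IsOpen (D i)) (hDd : Pairwise (Function.onFun Disjoint D))
    (hDU : ⋃ i, D i = univ) : C(X, Y) ≃ₜ+ ∀ i, C(D i, Y) where
  toFun f i := f.restrict (D i)
  invFun φ := ContinuousMap.liftCover D φ
    (fun i j x hi hj => by
      obtain rfl : i = j := hDd.eq (not_disjoint_iff.2 ⟨x, hi, hj⟩)
      rfl)
    (fun x => (iUnion_eq_univ_iff.1 hDU x).imp fun i hi => (hDo i).mem_nhds hi)
  left_inv f := by
    ext x
    obtain ⟨i, hi⟩ := iUnion_eq_univ_iff.1 hDU x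
    exact ContinuousMap.liftCover_coe (⟨x, hi⟩ : D i)
  right_inv φ := by
    ext i x
    simp only [ContinuousMap.restrict_apply]
    rw [ContinuousMap.liftCover_coe]
  map_add' _ _ := rfl
  continuous_toFun := continuous_pi fun i => ContinuousMap.continuous_restrict (D i)
  continuous_invFun := by
    rw [ContinuousMap.continuous_compactOpen]
    intro K hK U hU
    have hDf : LocallyFinite D := by
      intro x
      obtain ⟨i, hi⟩ := iUnion_eq_univ_iff.1 hDU x
      refine ⟨D i, (hDo i).mem_nhds hi, (finite_singleton i).subset ?_⟩
      rintro j ⟨y, hyj, hyi⟩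
      exact hDd.eq (not_disjoint_iff.2 ⟨y, hyj, hyi⟩)
    have hDc : ∀ i, IsClosed (D i) := by
      intro i
      have : (D i)ᶜ = ⋃ j : {j // j ≠ i}, D j := by
        ext x
        simp only [mem_compl_iff, mem_iUnion]
        constructor
        · intro hx
          obtain ⟨j, hj⟩ := iUnion_eq_univ_iff.1 hDU x
          exact ⟨⟨j, fun h => hx (h ▸ hj)⟩, hj⟩
        · rintro ⟨⟨j, hji⟩, hj⟩ hi
          exact disjoint_left.1 (hDd hji) hj hi
      exact ⟨this ▸ isOpen_iUnion fun j => hDo j⟩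
    have hfin := hDf.finite_nonempty_inter_compact hK
    have hopen : ∀ i, IsOpen {φ : ∀ i, C(D i, Y) | MapsTo (φ i) (Subtype.val ⁻¹' K) U} := fun i =>
      (ContinuousMap.isOpen_setOfPred_mapsTo (Y := Y)
        ((hDc i).isClosedEmbedding_subtypeVal.isCompact_preimage hK) hU).preimage
          (continuous_apply (A := fun i => C(D i, Y)) i)
    convert hfin.isOpen_biInter fun i _ => hopen i using 1
    ext φ
    simp only [mem_iInter]
    constructor
    · intro h i _ x hx
      have := h hx
      rwa [ContinuousMap.liftCover_coe] at this
    · intro h x hx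
      obtain ⟨i, hi⟩ := iUnion_eq_univ_iff.1 hDU x
      have := h i ⟨x, hi, hx⟩ (x := ⟨x, hi⟩) hx
      rwa [← ContinuousMap.liftCover_coe (⟨x, hi⟩ : D i)] at this

theorem polishSpace_continuousMap_of_compactSpace {K Y : Type*} [MetricSpace K] [CompactSpace K]
    [TopologicalSpace Y] [DiscreteTopology Y] [Countable Y] : PolishSpace C(K, Y) := by
  have : DiscreteTopology C(K, Y) := discreteTopology_continuousMap
  infer_instance

theorem IsZeroDimensional.isKRSpace_of_locallyCompactSpace {X : Type u} [MetricSpace X]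
    [LocallyCompactSpace X] (hX : IsZeroDimensional X) : IsKRSpace C(X, ZMod 2) := by
  obtain ⟨D, hDo, hDc, hDd, hDU⟩ := hX.exists_partition_isCompact_isOpen
  have (i : X) : CompactSpace (D i) := isCompact_iff_compactSpace.1 (hDc i)
  have (i : X) : DiscreteTopology C(D i, ZMod 2) := discreteTopology_continuousMap
  exact isKRSpace_pi_of_discreteTopology.of_homeomorph
    (ContinuousMap.piRestrict hDo hDd hDU).toHomeomorph.symm

theorem IsZeroDimensional.exists_continuousAddEquiv_pi_polishSpace {X : Type u} [MetricSpace X]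
    [LocallyCompactSpace X] (hX : IsZeroDimensional X) :
    ∃ (ι : Type u) (G : ι → Type u) (_ : ∀ i, AddCommGroup (G i))
      (_ : ∀ i, TopologicalSpace (G i)),
      (∀ i, IsTopologicalAddGroup (G i)) ∧ (∀ i, PolishSpace (G i)) ∧
        Nonempty (C(X, ZMod 2) ≃ₜ+ (∀ i, G i)) := by
  obtain ⟨D, hDo, hDc, hDd, hDU⟩ := hX.exists_partition_isCompact_isOpen
  have (i : X) : CompactSpace (D i) := isCompact_iff_compactSpace.1 (hDc i)
  exact ⟨X, fun i => C(D i, ZMod 2), fun i => inferInstance, fun i => inferInstance,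
    fun i => inferInstance, fun i => polishSpace_continuousMap_of_compactSpace,
    ⟨ContinuousMap.piRestrict hDo hDd hDU⟩⟩

/-! ### Filtrations around a set of non-isolated points -/

/-- A decreasing sequence of open sets `U n` that starts with the whole space, has nonempty
consecutive differences, and is a base of neighbourhoods of `A`. -/
structure IsNhdsFiltration {X : Type*} [TopologicalSpace X] (A : Set X) (U : ℕ → Set X) :
    Prop where
  zero : U 0 = univ
  antitone : Antitone U
  isOpen : ∀ n, IsOpen (U n)
  subset : ∀ n, A ⊆ U n
  nonempty : ∀ n, (U n \ U (n + 1)).Nonempty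
  exists_subset : ∀ O, IsOpen O → A ⊆ O → ∃ n, U n ⊆ O

theorem isOpen_of_disjoint_derivedSet {X : Type*} [TopologicalSpace X] {s : Set X}
    (hs : Disjoint s (derivedSet univ)) : IsOpen s := by
  rw [← biUnion_of_singleton s]
  refine isOpen_biUnion fun x hx => ?_
  have h : ¬ AccPt x (𝓟 univ) := fun h => disjoint_left.1 hs hx h
  rw [isOpen_singleton_iff_punctured_nhds]
  simpa [AccPt, neBot_iff] using h

theorem exists_isNhdsFiltration {X : Type u} [MetricSpace X] (hlc : ¬ LocallyCompactSpace X)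
    (hX' : IsCompact (derivedSet (univ : Set X))) :
    ∃ U : ℕ → Set X, IsNhdsFiltration (derivedSet univ) U := by
  have hno : ¬ IsOpen (derivedSet (univ : Set X)) := by
    intro ho
    have : WeaklyLocallyCompactSpace X := ⟨fun x => by
      by_cases hx : x ∈ derivedSet (univ : Set X)
      · exact ⟨_, hX', ho.mem_nhds hx⟩
      · exact ⟨{x}, isCompact_singleton, (isOpen_of_disjoint_derivedSet
          (disjoint_singleton_left.2 hx)).mem_nhds rfl⟩⟩
    exact hlc inferInstance
  have hg : ∀ V : {V : Set X // IsOpen V ∧ derivedSet univ ⊆ V},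
      ∃ x, x ∈ V.1 ∧ x ∉ derivedSet (univ : Set X) := by
    rintro ⟨V, hV, hAV⟩
    by_contra! h
    exact hno (hAV.antisymm h ▸ hV)
  choose g hgV hgA using hg
  -- Each step removes one isolated point and shrinks to a prescribed thickening.
  let W : ℕ → {V : Set X // IsOpen V ∧ derivedSet univ ⊆ V} := fun n =>
    Nat.rec ⟨univ, isOpen_univ, subset_univ _⟩ (fun n V =>
      ⟨V.1 ∩ Metric.thickening (1 / ((n : ℝ) + 1)) (derivedSet univ) ∩ {g V}ᶜ,
        (V.2.1.inter Metric.isOpen_thickening).inter isOpen_compl_singleton,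
        subset_inter (subset_inter V.2.2
          (Metric.self_subset_thickening Nat.one_div_pos_of_nat _))
          fun x hx h => hgA V (mem_singleton_iff.1 h ▸ hx)⟩) n
  have hW : ∀ n, (W (n + 1)).1 =
      (W n).1 ∩ Metric.thickening (1 / ((n : ℝ) + 1)) (derivedSet univ) ∩ {g (W n)}ᶜ := fun _ => rfl
  refine ⟨fun n => (W n).1, rfl, antitone_nat_of_succ_le fun n => ?_, fun n => (W n).2.1,
    fun n => (W n).2.2, fun n => ⟨g (W n), hgV _, ?_⟩, fun O hO hAO => ?_⟩
  · rw [hW]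
    exact fun x hx => hx.1.1
  · rw [hW]
    exact fun h => h.2 rfl
  · obtain ⟨δ, hδ, hδO⟩ := hX'.exists_thickening_subset_open hO hAO
    obtain ⟨n, hn⟩ := exists_nat_one_div_lt hδ
    refine ⟨n + 1, fun x hx => hδO (Metric.thickening_mono hn.le _ ?_)⟩
    change x ∈ (W (n + 1)).1 at hx
    rw [hW] at hx
    exact hx.1.2

namespace IsNhdsFiltration

variable {X : Type u} [TopologicalSpace X] {U : ℕ → Set X}

theorem exists_mem_diff [T1Space X] {A : Set X} (hU : IsNhdsFiltration A U) {x : X} (hx : x ∉ A) :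
    ∃ n, x ∈ U n \ U (n + 1) := by
  classical
  obtain ⟨n, hn⟩ := hU.exists_subset {x}ᶜ isOpen_compl_singleton
    fun y hy h => hx (mem_singleton_iff.1 h ▸ hy)
  have hex : ∃ n, x ∉ U n := ⟨n, fun h => hn h rfl⟩
  have hpos : Nat.find hex ≠ 0 := fun h => Nat.find_spec hex (by rw [h, hU.zero]; trivial)
  obtain ⟨m, hm⟩ := Nat.exists_eq_succ_of_ne_zero hpos
  refine ⟨m, ?_, ?_⟩
  · by_contra h
    have := Nat.find_min' hex h
    omega
  · have := Nat.find_spec hex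
    rwa [hm] at this

theorem eq_of_mem_diff {A : Set X} (hU : IsNhdsFiltration A U) {x : X} {m n : ℕ}
    (hm : x ∈ U m \ U (m + 1)) (hn : x ∈ U n \ U (n + 1)) : m = n := by
  rcases lt_trichotomy m n with h | h | h
  · exact absurd (hU.antitone h hn.1) hm.2
  · exact h
  · exact absurd (hU.antitone h hm.1) hn.2

variable (hU : IsNhdsFiltration (derivedSet univ) U)
include hU

theorem isOpen_of_disjoint {n : ℕ} {s : Set X} (hs : Disjoint s (U n)) : IsOpen s :=
  isOpen_of_disjoint_derivedSet (hs.mono_right (hU.subset n))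

theorem finite_diff_of_isCompact {K : Set X} (hK : IsCompact K) (n : ℕ) : (K \ U n).Finite := by
  refine (hK.diff (hU.isOpen n)).finite ?_
  rw [isDiscrete_iff_forall_mem_exists_isOpen]
  refine fun x hx => ⟨{x}, hU.isOpen_of_disjoint (disjoint_singleton_left.2 hx.2), ?_⟩
  simpa using hx

theorem isCompact_union (hX' : IsCompact (derivedSet (univ : Set X))) {B : Set X}
    (hB : ∀ n, (B \ U n).Finite) : IsCompact (derivedSet univ ∪ B) := by
  classical
  refine isCompact_of_finite_subcover fun {ι} V hV hcov => ?_
  obtain ⟨t, ht⟩ := hX'.elim_finite_subcover V hV (subset_union_left.trans hcov)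
  obtain ⟨n, hn⟩ := hU.exists_subset (⋃ i ∈ t, V i) (isOpen_biUnion fun i _ => hV i) ht
  obtain ⟨s, hs⟩ := (hB n).isCompact.elim_finite_subcover V hV
    (sdiff_subset.trans (subset_union_right.trans hcov))
  refine ⟨t ∪ s, ?_⟩
  rw [Finset.set_biUnion_union]
  rintro x (hx | hx)
  · exact Or.inl (ht hx)
  · by_cases hxn : x ∈ U n
    · exact Or.inl (hn hxn)
    · exact Or.inr (hs ⟨hx, hxn⟩)

/-- The function equal to `w` outside `U n` and to `0` on `U n`. It is continuous, because `U n` is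
an open set that contains all non-isolated points. -/
noncomputable def indicatorMap (n : ℕ) (w : X → ZMod 2) : C(X, ZMod 2) where
  toFun := (U n)ᶜ.indicator w
  continuous_toFun := continuous_def.2 fun s _ => by
    by_cases h0 : (0 : ZMod 2) ∈ s
    · rw [← union_sdiff_cancel (s := U n) (t := (U n)ᶜ.indicator w ⁻¹' s) fun x hx => by
        rwa [mem_preimage, indicator_of_notMem (notMem_compl_iff.2 hx)]]
      exact (hU.isOpen n).union (hU.isOpen_of_disjoint disjoint_sdiff_left)
    · refine hU.isOpen_of_disjoint (n := n) (disjoint_left.2 fun x hx hxn => h0 ?_)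
      rwa [mem_preimage, indicator_of_notMem (notMem_compl_iff.2 hxn)] at hx

end IsNhdsFiltration

theorem mem_nhds_pi_iff_exists_eqOn {ι Y : Type*} [TopologicalSpace Y] [DiscreteTopology Y]
    {w : ι → Y} {s : Set (ι → Y)} :
    s ∈ 𝓝 w ↔ ∃ F : Set ι, F.Finite ∧ ∀ v, EqOn v w F → v ∈ s := by
  rw [nhds_pi, Filter.mem_pi]
  constructor
  · rintro ⟨F, hF, t, ht, hts⟩
    refine ⟨F, hF, fun v hv => hts fun i hi => ?_⟩
    rw [hv hi]
    exact mem_of_mem_nhds (ht i)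
  · rintro ⟨F, hF, h⟩
    exact ⟨F, hF, fun i => {w i}, fun i => (isOpen_discrete _).mem_nhds rfl,
      fun v hv => h v fun i hi => hv i hi⟩

theorem isOpen_vanishingSubgroup {X : Type u} [TopologicalSpace X] {A : Set X}
    (hA : IsCompact A) : IsOpen (vanishingSubgroup X A : Set C(X, ZMod 2)) :=
  isOpen_setOf_eqOn 0 hA

theorem mem_nhds_vanishingSubgroup_iff {X : Type u} [TopologicalSpace X] {A : Set X}
    {f : vanishingSubgroup X A} {O : Set (vanishingSubgroup X A)} :
    O ∈ 𝓝 f ↔ ∃ K : Set X, IsCompact K ∧ ∀ g : vanishingSubgroup X A, EqOn g.1 f.1 K → g ∈ O := by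
  rw [nhds_subtype_eq_comap, mem_comap]
  constructor
  · rintro ⟨t, ht, htO⟩
    obtain ⟨K, hK, h⟩ := mem_nhds_iff_exists_eqOn.1 ht
    exact ⟨K, hK, fun g hg => htO (h g.1 hg)⟩
  · rintro ⟨K, hK, h⟩
    exact ⟨{g | EqOn g f.1 K}, mem_nhds_iff_exists_eqOn.2 ⟨K, hK, fun _ hg => hg⟩,
      fun g hg => h g hg⟩

/-! ### The open subgroup as a `k`-space -/

namespace IsNhdsFiltration

variable {X : Type u} [TopologicalSpace X] {U : ℕ → Set X}

theorem exists_eqOn_zero {A : Set X} (hU : IsNhdsFiltration A U) (f : vanishingSubgroup X A) :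
    ∃ n, EqOn f.1 0 (U n) :=
  hU.exists_subset (f.1 ⁻¹' {0}) ((isOpen_discrete _).preimage f.1.continuous) f.2

variable (hU : IsNhdsFiltration (derivedSet univ) U)
include hU

theorem continuous_indicatorMap (n : ℕ) : Continuous (hU.indicatorMap n) := by
  refine continuous_iff_continuousAt.2 fun w O hO => ?_
  obtain ⟨K, hK, h⟩ := mem_nhds_iff_exists_eqOn.1 hO
  refine mem_nhds_pi_iff_exists_eqOn.2 ⟨K \ U n, hU.finite_diff_of_isCompact hK n,
    fun v hv => h _ fun x hx => ?_⟩
  change (U n)ᶜ.indicator v x = (U n)ᶜ.indicator w x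
  by_cases hxn : x ∈ U n
  · simp [hxn]
  · simp [hxn, hv ⟨hx, hxn⟩]

theorem isCompact_setOf_eqOn_zero (n : ℕ) :
    IsCompact {f : vanishingSubgroup X (derivedSet univ) | EqOn f.1 0 (U n)} := by
  rw [Subtype.isCompact_iff]
  convert isCompact_range (hU.continuous_indicatorMap n)
  ext f
  constructor
  · rintro ⟨f, hf, rfl⟩
    refine ⟨f.1, ContinuousMap.ext fun x => ?_⟩
    change (U n)ᶜ.indicator f.1 x = f.1 x
    by_cases hxn : x ∈ U n
    · simpa [hxn] using (hf hxn).symm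
    · simp [hxn]
  · rintro ⟨w, rfl⟩
    have h0 : EqOn (hU.indicatorMap n w) 0 (U n) := fun x hx =>
      indicator_of_notMem (notMem_compl_iff.2 hx) w
    exact ⟨⟨_, fun x hx => h0 (hU.subset n hx)⟩, h0, rfl⟩

/-- Among the maps that vanish on `U n`, a compact set, agreement with `f` on an arbitrary set `T`
can be replaced by agreement on a finite subset of `T`. -/
theorem exists_finite_subset {A : Set (vanishingSubgroup X (derivedSet univ))}
    (hA : ∀ K, IsCompact K → IsOpen (Subtype.val ⁻¹' A : Set K))
    (f : vanishingSubgroup X (derivedSet univ)) (n : ℕ) (F T : Set X)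
    (h : ∀ g : vanishingSubgroup X (derivedSet univ), EqOn g.1 0 (U n) → EqOn g.1 f.1 (F ∪ T) →
      g ∈ A) :
    ∃ T' ⊆ T, T'.Finite ∧ ∀ g : vanishingSubgroup X (derivedSet univ), EqOn g.1 0 (U n) →
      EqOn g.1 f.1 (F ∪ T') → g ∈ A := by
  have hcl : ∀ x : X, IsClosed {g : vanishingSubgroup X (derivedSet univ) | g.1 x = f.1 x} :=
    fun x => isClosed_singleton.preimage
      ((ContinuousEvalConst.continuous_eval_const x).comp continuous_subtype_val)
  have hK := hU.isCompact_setOf_eqOn_zero n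
  obtain ⟨O, hO, hOA⟩ := isOpen_induced_iff.1 (hA _ hK)
  have hKO : ∀ g : vanishingSubgroup X (derivedSet univ), EqOn g.1 0 (U n) → (g ∈ O ↔ g ∈ A) :=
    fun g hg => Set.ext_iff.1 hOA ⟨g, hg⟩
  have hQ : IsCompact (({g : vanishingSubgroup X (derivedSet univ) | EqOn g.1 0 (U n)} \ O) ∩
      ⋂ x ∈ F, {g | g.1 x = f.1 x}) :=
    (hK.diff hO).inter_right (isClosed_biInter fun x _ => hcl x)
  obtain ⟨t, ht⟩ := hQ.elim_finite_subfamily_closed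
    (fun x : T => {g : vanishingSubgroup X (derivedSet univ) | g.1 x = f.1 x})
    (fun x => hcl x) (by
      rw [eq_empty_iff_forall_notMem]
      rintro g ⟨⟨⟨hgK, hgO⟩, hgF⟩, hgT⟩
      simp only [mem_iInter] at hgF hgT
      refine hgO ((hKO g hgK).2 (h g hgK ?_))
      rintro x (hx | hx)
      · exact hgF x hx
      · exact hgT ⟨x, hx⟩)
  refine ⟨Subtype.val '' (t : Set T), Subtype.coe_image_subset _ _, t.finite_toSet.image _,
    fun g hg hgF => (hKO g hg).1 ?_⟩
  by_contra hgO
  refine (eq_empty_iff_forall_notMem.1 ht) g ⟨⟨⟨hg, hgO⟩, ?_⟩, ?_⟩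
  · simp only [mem_iInter]
    exact fun x hx => hgF (Or.inl hx)
  · simp only [mem_iInter]
    exact fun x hx => hgF (Or.inr ⟨x, hx, rfl⟩)

/-- The subgroup of maps vanishing on the non-isolated points is the increasing union of the
compact subgroups of maps vanishing on `U n`. Given `A` relatively open in each of them and
`f ∈ A`, finite sets `F k` are chosen one step at a time, so that agreement with `f` on `F k` forces
the maps vanishing on `U (m + k)` into `A`. The union of the `F k` and of the non-isolated points is
a compact set which witnesses that `A` is a neighbourhood of `f`. -/
theorem compactlyCoherentSpace (hX' : IsCompact (derivedSet (univ : Set X))) :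
    CompactlyCoherentSpace (vanishingSubgroup X (derivedSet univ)) := by
  refine CompactlyCoherentSpace.of_isOpen fun A hA => isOpen_iff_mem_nhds.2 fun f hf => ?_
  obtain ⟨m, hm⟩ := hU.exists_eqOn_zero f
  let Good : ℕ → Set X → Prop := fun k F => F.Finite ∧
    ∀ g : vanishingSubgroup X (derivedSet univ), EqOn g.1 0 (U (m + k)) → EqOn g.1 f.1 F → g ∈ A
  have hstart : ∃ F, Good 0 F := by
    obtain ⟨T, -, hT, h⟩ := hU.exists_finite_subset hA f m ∅ univ fun g _ hg => by
      have : g = f := Subtype.ext (ContinuousMap.ext fun x => hg (Or.inr trivial))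
      exact this ▸ hf
    exact ⟨T, hT, fun g hg hgT => h g hg (by rwa [empty_union])⟩
  have hstep : ∀ k F, Good k F → ∃ F', Good (k + 1) F' ∧ F ⊆ F' ∧ F' \ F ⊆ U (m + k) := by
    rintro k F ⟨hF, h⟩
    obtain ⟨T, hTU, hT, hTA⟩ := hU.exists_finite_subset hA f (m + k + 1) F
      (U (m + k) \ U (m + k + 1)) fun g hg hgF => by
        refine h g (fun x hx => ?_) fun x hx => hgF (Or.inl hx)
        by_cases hx' : x ∈ U (m + k + 1)
        · exact hg hx'
        · rw [hgF (Or.inr ⟨hx, hx'⟩)]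
          exact hm (hU.antitone (Nat.le_add_right m k) hx)
    exact ⟨F ∪ T, ⟨hF.union hT, hTA⟩, subset_union_left,
      fun x hx => (hTU (hx.1.resolve_left hx.2)).1⟩
  choose! next hnext hsub hdiff using hstep
  obtain ⟨F₀, hF₀⟩ := hstart
  let F : ℕ → Set X := fun k => Nat.rec F₀ next k
  have hF : ∀ k, Good k (F k) := fun k => by
    induction k with
    | zero => exact hF₀
    | succ k ih => exact hnext k _ ih
  have hmono : Monotone F := monotone_nat_of_le_succ fun k => hsub k _ (hF k)
  have hFU : ∀ k j, F j \ U (m + k) ⊆ F k := by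
    intro k j
    induction j with
    | zero => exact fun x hx => hmono (Nat.zero_le k) hx.1
    | succ j ih =>
      rintro x ⟨hx, hxU⟩
      rcases Classical.em (x ∈ F j) with hxj | hxj
      · exact ih ⟨hxj, hxU⟩
      · have hxU' : x ∈ U (m + j) := hdiff j _ (hF j) ⟨hx, hxj⟩
        have hjk : j < k := by
          by_contra hkj
          exact hxU (hU.antitone (by omega) hxU')
        exact hmono hjk hx
  have hK : IsCompact (derivedSet univ ∪ ⋃ k, F k) := by
    refine hU.isCompact_union hX' fun n => (hF n).1.subset ?_
    rintro x ⟨hx, hxn⟩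
    obtain ⟨j, hj⟩ := mem_iUnion.1 hx
    exact hFU n j ⟨hj, fun h => hxn (hU.antitone (Nat.le_add_left n m) h)⟩
  refine mem_nhds_vanishingSubgroup_iff.2 ⟨_, hK, fun g hg => ?_⟩
  obtain ⟨n, hn⟩ := hU.exists_eqOn_zero g
  exact (hF n).2 g (fun x hx => hn (hU.antitone (Nat.le_add_left n m) hx))
    fun x hx => hg (Or.inr (mem_iUnion.2 ⟨n, hx⟩))

end IsNhdsFiltration

theorem isKRSpace_of_isOpen_addSubgroup {G : Type u} [TopologicalSpace G] [AddGroup G]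
    [IsTopologicalAddGroup G] {H : AddSubgroup G} (hH : IsOpen (H : Set G))
    [CompactlyCoherentSpace H] : IsKRSpace G := by
  intro f
  refine ⟨fun hf K _ => hf.comp continuous_subtype_val, fun hf => ?_⟩
  refine continuous_iff_continuousAt.2 fun g => ?_
  have hcont : Continuous fun h : H => f (g + h) := by
    rw [CompactlyCoherentSpace.isCoherentWith.continuous_iff]
    intro K hK
    have hgK : Continuous fun h : H => g + (h : G) := continuous_const.add continuous_subtype_val
    exact (continuousOn_iff_continuous_domRestrict.2 (hf _ (hK.image hgK))).comp hgK.continuousOn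
      (mapsTo_image _ K)
  have h0 : ContinuousAt (fun h : G => f (g + h)) 0 :=
    (hH.isOpenEmbedding_subtypeVal.continuousAt_iff (g := fun h : G => f (g + h))
      (x := (0 : H))).1 hcont.continuousAt
  have h1 : ContinuousAt (fun y : G => -g + y) g := (continuous_const.add continuous_id).continuousAt
  have := ContinuousAt.comp_of_eq (g := fun h : G => f (g + h)) h0 h1 (by simp)
  simpa [Function.comp_def] using this

/-! ### The open subgroup as a box sum -/

theorem mem_nhds_boxTopology_iff {G : ℕ → Type u} [∀ n, TopologicalSpace (G n)] {x : ∀ n, G n}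
    {s : Set (∀ n, G n)} :
    s ∈ @nhds _ (boxTopology G) x ↔ ∃ V : ∀ n, Set (G n), (∀ n, V n ∈ 𝓝 (x n)) ∧
      ∀ y, (∀ n, y n ∈ V n) → y ∈ s := by
  let _ : TopologicalSpace (∀ n, G n) := boxTopology G
  have hB : TopologicalSpace.IsTopologicalBasis
      {B | ∃ U : ∀ n, Set (G n), (∀ n, IsOpen (U n)) ∧ B = {x : ∀ n, G n | ∀ n, x n ∈ U n}} := by
    refine ⟨?_, ?_, rfl⟩
    · rintro _ ⟨U, hU, rfl⟩ _ ⟨V, hV, rfl⟩ y ⟨hyU, hyV⟩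
      exact ⟨_, ⟨fun n => U n ∩ V n, fun n => (hU n).inter (hV n), rfl⟩,
        fun n => ⟨hyU n, hyV n⟩, fun z hz => ⟨fun n => (hz n).1, fun n => (hz n).2⟩⟩
    · exact eq_univ_of_forall fun y => mem_sUnion.2
        ⟨_, ⟨fun _ => univ, fun _ => isOpen_univ, rfl⟩, fun _ => trivial⟩
  rw [hB.mem_nhds_iff]
  constructor
  · rintro ⟨_, ⟨U, hU, rfl⟩, hx, hs⟩
    exact ⟨U, fun n => (hU n).mem_nhds (hx n), fun y hy => hs hy⟩
  · rintro ⟨V, hV, hs⟩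
    exact ⟨_, ⟨fun n => interior (V n), fun n => isOpen_interior, rfl⟩,
      fun n => mem_interior_iff_mem_nhds.2 (hV n), fun y hy => hs y fun n => interior_subset (hy n)⟩

section Layers

variable {X : Type u} {U : ℕ → Set X}

/-- The cardinals of the differences of consecutive members of a filtration. -/
noncomputable abbrev layerCard (U : ℕ → Set X) (n : ℕ) : Cardinal.{u} :=
  Cardinal.mk ↥(U n \ U (n + 1))

/-- The point of the `n`-th difference with a given index. -/
noncomputable def layerPoint (U : ℕ → Set X) (n : ℕ) (c : (layerCard U n).out) : X :=
  (Cardinal.outMkEquiv c : ↥(U n \ U (n + 1)))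

theorem layerPoint_mem (n : ℕ) (c : (layerCard U n).out) :
    layerPoint U n c ∈ U n \ U (n + 1) :=
  (Cardinal.outMkEquiv c : ↥(U n \ U (n + 1))).2

theorem layerPoint_injective (n : ℕ) : Function.Injective (layerPoint U n) :=
  Subtype.val_injective.comp Cardinal.outMkEquiv.injective

theorem exists_layerPoint_eq {n : ℕ} {x : X} (hx : x ∈ U n \ U (n + 1)) :
    ∃ c, layerPoint U n c = x :=
  ⟨Cardinal.outMkEquiv.symm ⟨x, hx⟩, by simp [layerPoint]⟩

end Layers

namespace IsNhdsFiltration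

variable {X : Type u} [TopologicalSpace X] {U : ℕ → Set X}

theorem exists_finset_layerPoint_eq_zero {A : Set X} (hU : IsNhdsFiltration A U)
    (f : vanishingSubgroup X A) :
    ∃ s : Finset ℕ, ∀ n ∉ s, ∀ c, f.1 (layerPoint U n c) = 0 := by
  obtain ⟨m, hm⟩ := hU.exists_eqOn_zero f
  exact ⟨Finset.range m, fun n hn c => hm (hU.antitone (by simpa using hn) (layerPoint_mem n c).1)⟩

/-- The map that restricts a function to the differences of consecutive members of a filtration.
It has finite support, because a function that vanishes on `A` vanishes on some `U n`. -/
noncomputable def toBoxDirectSum {A : Set X} (hU : IsNhdsFiltration A U)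
    (f : vanishingSubgroup X A) : BoxDirectSum fun n => TwoPow (layerCard U n) :=
  (DFinsupp.mk (β := fun n => TwoPow (layerCard U n))
    (hU.exists_finset_layerPoint_eq_zero f).choose fun n c => f.1 (layerPoint U n c) :
      DirectSum ℕ fun n => TwoPow (layerCard U n))

/-- The coordinates of an element of the box sum, as an additive map to the full product. -/
def boxCoord (G : ℕ → Type u) [∀ n, AddCommGroup (G n)] : BoxDirectSum G →+ ∀ n, G n :=
  DFinsupp.coeFnAddMonoidHom (β := G)

theorem boxCoord_injective (G : ℕ → Type u) [∀ n, AddCommGroup (G n)] :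
    Function.Injective (boxCoord G) :=
  DFunLike.coe_injective (F := DirectSum ℕ G)

theorem boxCoord_toBoxDirectSum {A : Set X} (hU : IsNhdsFiltration A U)
    (f : vanishingSubgroup X A) :
    boxCoord _ (hU.toBoxDirectSum f) = fun n c => f.1 (layerPoint U n c) := by
  funext n
  by_cases hn : n ∈ (hU.exists_finset_layerPoint_eq_zero f).choose
  · exact DFinsupp.mk_of_mem (β := fun n => TwoPow (layerCard U n))
      (x := fun n c => f.1 (layerPoint U n c)) hn
  · refine (DFinsupp.mk_of_notMem (β := fun n => TwoPow (layerCard U n))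
      (x := fun n c => f.1 (layerPoint U n c)) hn).trans (funext fun c => ?_)
    exact ((hU.exists_finset_layerPoint_eq_zero f).choose_spec n hn c).symm

theorem toBoxDirectSum_add {A : Set X} (hU : IsNhdsFiltration A U) (f g : vanishingSubgroup X A) :
    hU.toBoxDirectSum (f + g) = hU.toBoxDirectSum f + hU.toBoxDirectSum g := by
  apply boxCoord_injective
  rw [map_add]
  simp only [boxCoord_toBoxDirectSum]
  rfl

theorem toBoxDirectSum_injective [T1Space X] {A : Set X} (hU : IsNhdsFiltration A U) :
    Function.Injective hU.toBoxDirectSum := by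
  intro f g hfg
  have h := congrArg (boxCoord _) hfg
  simp only [boxCoord_toBoxDirectSum] at h
  refine Subtype.ext (ContinuousMap.ext fun x => ?_)
  by_cases hx : x ∈ A
  · rw [f.2 x hx, g.2 x hx]
  · obtain ⟨n, hn⟩ := hU.exists_mem_diff hx
    obtain ⟨c, rfl⟩ := exists_layerPoint_eq hn
    exact congrFun (congrFun h n) c

theorem toBoxDirectSum_surjective (hU : IsNhdsFiltration (derivedSet univ) U) :
    Function.Surjective hU.toBoxDirectSum := by
  classical
  intro y
  let φ := AddMonoidHom.mk' hU.toBoxDirectSum hU.toBoxDirectSum_add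
  change y ∈ range φ
  rw [← AddMonoidHom.coe_range, SetLike.mem_coe]
  refine DirectSum.induction_on (β := fun n => TwoPow (layerCard U n))
    (motive := fun y => y ∈ φ.range) y (zero_mem _) (fun n v => ?_) fun _ _ => add_mem
  -- The preimage of a single term `v` is the extension of `v` by zero from the `n`-th difference.
  let w : X → ZMod 2 := fun x =>
    if h : x ∈ U n \ U (n + 1) then v (Cardinal.outMkEquiv.symm ⟨x, h⟩) else 0
  have hw : ∀ x, x ∈ U (n + 1) → hU.indicatorMap (n + 1) w x = 0 := fun x hx =>
    indicator_of_notMem (notMem_compl_iff.2 hx) w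
  have hw' : ∀ x, hU.indicatorMap (n + 1) w x = w x := fun x => by
    by_cases hx : x ∈ U (n + 1)
    · rw [hw x hx]
      simp [w, hx]
    · exact indicator_of_mem hx w
  refine ⟨⟨hU.indicatorMap (n + 1) w, fun x hx => hw x (hU.subset _ hx)⟩, ?_⟩
  apply boxCoord_injective
  refine (hU.boxCoord_toBoxDirectSum _).trans ?_
  funext m c
  change hU.indicatorMap (n + 1) w _ =
    (DirectSum.of (fun n => TwoPow (layerCard U n)) n v) m c
  rw [hw']
  rcases eq_or_ne n m with rfl | hnm
  · rw [DirectSum.of_eq_same]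
    simp only [w, dif_pos (layerPoint_mem n c)]
    exact congrArg v (Cardinal.outMkEquiv.symm_apply_apply c)
  · rw [DirectSum.of_eq_of_ne _ _ _ hnm.symm]
    exact dif_neg fun h => hnm (hU.eq_of_mem_diff h (layerPoint_mem m c))

/-- A compact set meets every difference `U n \ U (n + 1)` in a finite set, and conversely the union
of the non-isolated points with finite subsets of all the differences is compact. So the basic
neighbourhoods for the compact-open topology are the boxes. -/
theorem isInducing_toBoxDirectSum [T1Space X] (hU : IsNhdsFiltration (derivedSet univ) U)
    (hX' : IsCompact (derivedSet (univ : Set X))) : IsInducing hU.toBoxDirectSum := by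
  let _ : TopologicalSpace (∀ n, TwoPow (layerCard U n)) :=
    boxTopology fun n => TwoPow (layerCard U n)
  have hcoord : IsInducing (boxCoord fun n => TwoPow (layerCard U n)) := ⟨rfl⟩
  refine (hcoord.of_comp_iff).1 (isInducing_iff_nhds.2 fun f => Filter.ext fun O => ?_)
  rw [mem_nhds_vanishingSubgroup_iff, mem_comap]
  simp only [Function.comp_apply, boxCoord_toBoxDirectSum]
  constructor
  · rintro ⟨K, hK, h⟩
    refine ⟨_, mem_nhds_boxTopology_iff.2 ⟨fun n => {v | ∀ c, layerPoint U n c ∈ K →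
      v c = f.1 (layerPoint U n c)}, fun n => ?_, fun y hy => hy⟩, fun g hg => h g fun x hx => ?_⟩
    · refine mem_nhds_pi_iff_exists_eqOn.2 ⟨layerPoint U n ⁻¹' (K \ U (n + 1)),
        (hU.finite_diff_of_isCompact hK (n + 1)).preimage (layerPoint_injective n).injOn,
        fun v hv c hc => hv ⟨hc, (layerPoint_mem n c).2⟩⟩
    · by_cases hxA : x ∈ derivedSet univ
      · rw [f.2 x hxA, g.2 x hxA]
      · obtain ⟨n, hn⟩ := hU.exists_mem_diff hxA
        obtain ⟨c, rfl⟩ := exists_layerPoint_eq hn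
        have := hg n c hx
        simpa only [Function.comp_apply, boxCoord_toBoxDirectSum] using this
  · rintro ⟨s, hs, hsO⟩
    obtain ⟨V, hV, hVs⟩ := mem_nhds_boxTopology_iff.1 hs
    choose F hF hFV using fun n => mem_nhds_pi_iff_exists_eqOn.1 (hV n)
    refine ⟨derivedSet univ ∪ ⋃ n, layerPoint U n '' F n, hU.isCompact_union hX' fun n => ?_,
      fun g hg => hsO (hVs _ fun n => hFV n _ fun c hc => ?_)⟩
    · refine ((finite_lt_nat n).biUnion fun j _ => (hF j).image (layerPoint U j)).subset ?_
      rintro x ⟨hx, hxn⟩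
      obtain ⟨j, c, hc, rfl⟩ := mem_iUnion.1 hx
      refine mem_biUnion (x := j) ?_ ⟨c, hc, rfl⟩
      by_contra hj
      exact hxn (hU.antitone (not_lt.1 hj) (layerPoint_mem j c).1)
    · simp only [Function.comp_apply, boxCoord_toBoxDirectSum]
      exact hg (Or.inr (mem_iUnion.2 ⟨n, c, hc, rfl⟩))

theorem exists_continuousAddEquiv_boxDirectSum [T1Space X]
    (hU : IsNhdsFiltration (derivedSet univ) U) (hX' : IsCompact (derivedSet (univ : Set X))) :
    ∃ κ : ℕ → Cardinal.{u}, (∀ n, κ n ≠ 0) ∧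
      Nonempty (vanishingSubgroup X (derivedSet univ) ≃ₜ+ BoxDirectSum fun n => TwoPow (κ n)) := by
  refine ⟨layerCard U, fun n => ?_, ⟨?_⟩⟩
  · have := (hU.nonempty n).to_subtype
    exact Cardinal.mk_ne_zero _
  · let e := Equiv.ofBijective hU.toBoxDirectSum
      ⟨hU.toBoxDirectSum_injective, hU.toBoxDirectSum_surjective⟩
    let E := e.toHomeomorphOfIsInducing (hU.isInducing_toBoxDirectSum hX')
    exact { e with
      map_add' := hU.toBoxDirectSum_add
      continuous_toFun := E.continuous
      continuous_invFun := E.symm.continuous }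

end IsNhdsFiltration

/-! ### The equivalence and the structure of `C(X, 2)` -/

theorem theorem3p3 (X : Type u) [MetricSpace X] (hX : IsZeroDimensional X) :
    List.TFAE
      [IsAscoliSpace C(X, ZMod 2),
        IsKRSpace C(X, ZMod 2),
        LocallyCompactSpace X ∨
          (¬ LocallyCompactSpace X ∧ IsCompact (derivedSet (Set.univ : Set X)))] ∧
    (LocallyCompactSpace X →
      ∃ (ι : Type u) (G : ι → Type u) (_ : ∀ i, AddCommGroup (G i))
        (_ : ∀ i, TopologicalSpace (G i)),
        (∀ i, IsTopologicalAddGroup (G i)) ∧ (∀ i, PolishSpace (G i)) ∧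
          Nonempty (C(X, ZMod 2) ≃ₜ+ (∀ i, G i))) ∧
    (¬ LocallyCompactSpace X → IsCompact (derivedSet (Set.univ : Set X)) →
      IsOpen (vanishingSubgroup X (derivedSet Set.univ) : Set C(X, ZMod 2)) ∧
      CompactlyCoherentSpace (vanishingSubgroup X (derivedSet Set.univ)) ∧
      ∃ κ : ℕ → Cardinal.{u}, (∀ n, κ n ≠ 0) ∧
        Nonempty (vanishingSubgroup X (derivedSet Set.univ) ≃ₜ+
          BoxDirectSum (fun n => TwoPow (κ n)))) := by
  refine ⟨?_, fun _ => hX.exists_continuousAddEquiv_pi_polishSpace, fun hlc hX' => ?_⟩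
  · tfae_have 1 → 3 := by
      intro h
      by_contra! hcon
      exact not_isAscoliSpace_of_not_locallyCompactSpace hX hcon.1 (hcon.2 hcon.1) h
    tfae_have 3 → 2 := by
      rintro (_ | ⟨hlc, hX'⟩)
      · exact hX.isKRSpace_of_locallyCompactSpace
      · obtain ⟨U, hU⟩ := exists_isNhdsFiltration hlc hX'
        have := hU.compactlyCoherentSpace hX'
        exact isKRSpace_of_isOpen_addSubgroup (isOpen_vanishingSubgroup hX')
    tfae_have 2 → 1 := IsKRSpace.isAscoliSpace
    tfae_finish
  · obtain ⟨U, hU⟩ := exists_isNhdsFiltration hlc hX'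
    exact ⟨isOpen_vanishingSubgroup hX', hU.compactlyCoherentSpace hX',
      hU.exists_continuousAddEquiv_boxDirectSum hX'⟩
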